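/- Let $(M,\mathcal P)$ be a (finite-dimensional, Hausdorff, smooth) Poisson manifold, with bracket $\{f,g\}=\mathcal P(df,dg)$, $\mathcal P^\sharp:T^*M\to TM$, $\alpha\mapsto\mathcal P(\alpha,\cdot)$, and Hamiltonian vector fields $v_f=\{\cdot,f\}$. Let $\pi:M\to B$ be a surjective smooth submersion onto a Hausdorff smooth manifold $B$, with connected fibres of dimension $d\ge 1$; the fibres are called the leaves $R$, so $B=M/R$. A *leaf structure* is a smooth symmetric contravariant $2$-tensor $\mathcal S$ on $M$ such that $\mathrm{im}\,\mathcal S^\sharp=\ker d\pi$ at every point, where $\mathcal S^\sharp\alpha=\mathcal S(\alpha,\cdot)$; it is the same as a smoothly varying family of pseudo-Riemannian metrics $\mathcal G_R$ on the leaves, $\mathcal G_R(\mathcal S^\sharp\alpha,\mathcal S^\sharp\beta)=\mathcal S(\alpha,\beta)$. It is *compatible* if $\mathcal L_{v_{f\circ\pi}}\mathcal S=0$ for all $f\in C^\infty(B)$. Assume that $\mathcal S$ is a compatible leaf structure. 1. The following are equivalent: (a) The pseudo-Riemannian structures on the leaves can be chosen independently of one another. That is: if $\mathcal S'$ is a leaf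 structure such that for each leaf $R$ there is a compatible leaf structure (depending on $R$) which induces the same metric on $R$ as $\mathcal S'$, then $\mathcal S'$ is compatible. (b) Every leaf $R$ is a coisotropic submanifold of $(M,\mathcal P)$, i.e. $\mathcal P^\sharp(N^*_pR)\subset T_pR$ for all $p\in R$, where $N^*_pR\subset T_p^*M$ is the annihilator of $T_pR$. 2. Suppose that all leaves are coisotropic. Then for every leaf $R$ and every $p\in R$, with $k=\dim \mathcal P^\sharp(\ker\mathcal S^\sharp_p)$, there are $k$ Killing vector fields of $(R,\mathcal G_R)$, defined on all of $R$, whose values at $p$ are linearly independent (in particular they are linearly independent as vector fields on $R$). -/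

import Mathlib

open scoped Manifold ContDiff

noncomputable section

namespace PoissonGravity

section Tensors

variable {E : Type*} [NormedAddCommGroup E] [NormedSpace ℝ E]
  {M : Type*} [TopologicalSpace M] [ChartedSpace E M]

/-- The differential `df` at `p` of a real function on `M`, as an element of `T*_p M`. -/
def dAt (f : M → ℝ) (p : M) : TangentSpace 𝓘(ℝ, E) p →L[ℝ] ℝ :=
  mfderiv 𝓘(ℝ, E) 𝓘(ℝ, ℝ) f p

variable (E M) in
/-- A smooth contravariant 2-tensor field `T` on `M`, given by its maps
`T♯ : T*_p M → T_p M`, `α ↦ T(α, ·)`, so that `T(α, β) = β (T♯ α)`.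
Smoothness: `T(df, dg)` is a smooth function for all smooth functions `f`, `g`. -/
structure ContraTensor where
  sharp : ∀ p : M, (TangentSpace 𝓘(ℝ, E) p →L[ℝ] ℝ) →ₗ[ℝ] TangentSpace 𝓘(ℝ, E) p
  smooth : ∀ f g : C^∞⟮𝓘(ℝ, E), M; ℝ⟯,
    ContMDiff 𝓘(ℝ, E) 𝓘(ℝ, ℝ) ∞ (fun p ↦ dAt (E := E) g p (sharp p (dAt f p)))

/-- The value `T(α, β)` at `p` for two covectors `α, β ∈ T*_p M`. -/
def ContraTensor.pair (T : ContraTensor E M) (p : M)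
    (α β : TangentSpace 𝓘(ℝ, E) p →L[ℝ] ℝ) : ℝ :=
  β (T.sharp p α)

/-- The smooth function `T(df, dg)`. -/
def ContraTensor.contract (T : ContraTensor E M) (f g : C^∞⟮𝓘(ℝ, E), M; ℝ⟯) :
    C^∞⟮𝓘(ℝ, E), M; ℝ⟯ :=
  ⟨fun p ↦ T.pair p (dAt f p) (dAt g p), T.smooth f g⟩

/-- `T` is symmetric. -/
def ContraTensor.IsSymmetric (T : ContraTensor E M) : Prop :=
  ∀ p α β, T.pair p α β = T.pair p β α

/-- `T` is a Poisson tensor: it is antisymmetric, and the bracket `{f, g} = T(df, dg)` satisfies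
the Jacobi identity. -/
structure ContraTensor.IsPoisson (T : ContraTensor E M) : Prop where
  antisymm : ∀ p α β, T.pair p α β = -T.pair p β α
  jacobi : ∀ f g h : C^∞⟮𝓘(ℝ, E), M; ℝ⟯,
    T.contract f (T.contract g h) + T.contract g (T.contract h f)
      + T.contract h (T.contract f g) = 0

/-- The Hamiltonian vector field `v_f = {·, f} = -P♯ df`. -/
def hamiltonianField (P : ContraTensor E M) (f : M → ℝ) (p : M) : TangentSpace 𝓘(ℝ, E) p :=
  -P.sharp p (dAt f p)

/-- The Lie derivative `(L_v T)(dg, dh) = v(T(dg, dh)) - T(d(v g), dh) - T(dg, d(v h))` at `p`.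
Since `L_v T` is a tensor, these values determine it. -/
def lieDeriv (v : ∀ p : M, TangentSpace 𝓘(ℝ, E) p) (T : ContraTensor E M)
    (g h : C^∞⟮𝓘(ℝ, E), M; ℝ⟯) (p : M) : ℝ :=
  dAt (E := E) (T.contract g h) p (v p)
    - T.pair p (dAt (fun q ↦ dAt (E := E) g q (v q)) p) (dAt h p)
    - T.pair p (dAt g p) (dAt (fun q ↦ dAt (E := E) h q (v q)) p)

open Classical in
/-- The pseudo-Riemannian metric `𝒢` on the distribution `im S♯` that is inverse to a symmetric
tensor `S`: `𝒢(S♯ α, w) = α w` for `w ∈ im S♯` (independent of the choice of `α`, because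
`ker S♯` annihilates `im S♯`).  Only vectors in `im S♯` are ever inserted. -/
def imageMetric (S : ContraTensor E M) (p : M) (u w : TangentSpace 𝓘(ℝ, E) p) : ℝ :=
  if h : ∃ α : TangentSpace 𝓘(ℝ, E) p →L[ℝ] ℝ, S.sharp p α = u then h.choose w else 0

/-- A smooth vector field `X` is a Killing vector field of the covariant 2-tensor field `g`:
`L_X g = 0`, that is `X(g(Y, Z)) = g([X, Y], Z) + g(Y, [X, Z])` for all smooth `Y`, `Z`. -/
def IsKillingField [IsManifold 𝓘(ℝ, E) ∞ M]
    (g : ∀ p : M, TangentSpace 𝓘(ℝ, E) p → TangentSpace 𝓘(ℝ, E) p → ℝ)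
    (X : ∀ p : M, TangentSpace 𝓘(ℝ, E) p) : Prop :=
  ContMDiff 𝓘(ℝ, E) 𝓘(ℝ, E).tangent ∞ (fun p ↦ (⟨p, X p⟩ : TangentBundle 𝓘(ℝ, E) M)) ∧
  ∀ Y Z : ∀ p : M, TangentSpace 𝓘(ℝ, E) p,
    ContMDiff 𝓘(ℝ, E) 𝓘(ℝ, E).tangent ∞ (fun p ↦ (⟨p, Y p⟩ : TangentBundle 𝓘(ℝ, E) M)) →
    ContMDiff 𝓘(ℝ, E) 𝓘(ℝ, E).tangent ∞ (fun p ↦ (⟨p, Z p⟩ : TangentBundle 𝓘(ℝ, E) M)) →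
    ∀ p : M, dAt (fun q ↦ g q (Y q) (Z q)) p (X p)
      = g p (VectorField.mlieBracket 𝓘(ℝ, E) X Y p) (Z p)
        + g p (Y p) (VectorField.mlieBracket 𝓘(ℝ, E) X Z p)

end Tensors

section Fibration

variable {E : Type*} [NormedAddCommGroup E] [NormedSpace ℝ E]
  {F : Type*} [NormedAddCommGroup F] [NormedSpace ℝ F]
  {M : Type*} [TopologicalSpace M] [ChartedSpace E M]
  {B : Type*} [TopologicalSpace B] [ChartedSpace F B]

variable (E F) in
/-- The tangent space at `p` of the leaf (fibre of `π`) through `p`. -/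
def leafTangent (π : M → B) (p : M) : Submodule ℝ (TangentSpace 𝓘(ℝ, E) p) :=
  LinearMap.ker (mfderiv 𝓘(ℝ, E) 𝓘(ℝ, F) π p).toLinearMap

/-- The leaf `R` of `M` over the point `b` of the leaf space `B = M/R`. -/
abbrev Leaf (π : M → B) (b : B) : Type _ := {p : M // π p = b}

variable (E F) in
/-- `π : M → B` is a fibration of `M` into connected `d`-dimensional leaves: a smooth surjective
submersion whose fibres are connected and of dimension `d`. -/
structure IsLeafFibration (π : M → B) (d : ℕ) : Prop where
  smooth : ContMDiff 𝓘(ℝ, E) 𝓘(ℝ, F) ∞ π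
  submersion : ∀ p, Function.Surjective (mfderiv 𝓘(ℝ, E) 𝓘(ℝ, F) π p)
  connected : ∀ b, IsConnected (π ⁻¹' {b})
  dim : ∀ p, Module.finrank ℝ (leafTangent E F π p) = d

variable (F) in
/-- `S` is a symmetric tensor with `im S♯` the tangent distribution of the leaves; equivalently,
through `imageMetric`, a smoothly varying family of pseudo-Riemannian metrics on the leaves. -/
structure IsLeafStructure (π : M → B) (S : ContraTensor E M) : Prop where
  symmetric : S.IsSymmetric
  image : ∀ p, LinearMap.range (S.sharp p) = leafTangent E F π p

variable (F) in
/-- The compatibility condition `L_{v_f} S = 0` for all `f ∈ C^∞(M/R)`. -/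
def IsCompatible (P : ContraTensor E M) (π : M → B) (S : ContraTensor E M) : Prop :=
  ∀ f : C^∞⟮𝓘(ℝ, F), B; ℝ⟯, ∀ (g h : C^∞⟮𝓘(ℝ, E), M; ℝ⟯) (p : M),
    lieDeriv (hamiltonianField P (fun q ↦ f (π q))) S g h p = 0

variable (F) in
/-- `S` and `S'` induce the same pseudo-Riemannian metric on the leaf over `b`. -/
def SameLeafMetric (π : M → B) (S S' : ContraTensor E M) (b : B) : Prop :=
  ∀ p, π p = b → ∀ u ∈ leafTangent E F π p, ∀ w ∈ leafTangent E F π p,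
    imageMetric S p u w = imageMetric S' p u w

variable (F) in
/-- The pseudo-Riemannian structures on the leaves can be chosen independently of one another:
if, for each leaf separately, one picks a metric that occurs on this leaf in some compatible
structure, and the chosen metrics vary smoothly, then the resulting structure is compatible. -/
def LeafMetricsIndependent (P : ContraTensor E M) (π : M → B) : Prop :=
  ∀ S : ContraTensor E M, IsLeafStructure F π S →
    (∀ b : B, ∃ S' : ContraTensor E M,
      IsLeafStructure F π S' ∧ IsCompatible F P π S' ∧ SameLeafMetric F π S S' b) →
    IsCompatible F P π S

variable (F) in
/-- The leaf `R` over `b` is coisotropic: `P♯` maps the conormal space `N*_p R` into `T_p R`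
for each `p ∈ R`. -/
def IsCoisotropicLeaf (P : ContraTensor E M) (π : M → B) (b : B) : Prop :=
  ∀ p, π p = b → ∀ α : TangentSpace 𝓘(ℝ, E) p →L[ℝ] ℝ,
    (∀ u ∈ leafTangent E F π p, α u = 0) → P.sharp p α ∈ leafTangent E F π p

/-- The subspace `P♯(ker S♯)` of `T_p M`. -/
def sharpKer (P S : ContraTensor E M) (p : M) : Submodule ℝ (TangentSpace 𝓘(ℝ, E) p) :=
  (LinearMap.ker (S.sharp p)).map (P.sharp p)

variable (E) in
/-- The atlas with which the leaf is equipped makes it a submanifold of `M`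
(embedded, as it carries the subspace topology): the inclusion is a smooth immersion. -/
structure IsLeafSubmanifold (π : M → B) (b : B) (d : ℕ)
    [ChartedSpace (EuclideanSpace ℝ (Fin d)) (Leaf π b)] : Prop where
  smooth : ContMDiff 𝓘(ℝ, EuclideanSpace ℝ (Fin d)) 𝓘(ℝ, E) ∞ (Subtype.val : Leaf π b → M)
  immersion : ∀ q : Leaf π b, Function.Injective
    (mfderiv 𝓘(ℝ, EuclideanSpace ℝ (Fin d)) 𝓘(ℝ, E) (Subtype.val : Leaf π b → M) q)

/-- The metric `𝒢_R` on the leaf `R` over `b`. -/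
def leafMetric (S : ContraTensor E M) (π : M → B) (b : B) (d : ℕ)
    [ChartedSpace (EuclideanSpace ℝ (Fin d)) (Leaf π b)] (q : Leaf π b)
    (u w : TangentSpace 𝓘(ℝ, EuclideanSpace ℝ (Fin d)) q) : ℝ :=
  imageMetric S q.1
    (mfderiv 𝓘(ℝ, EuclideanSpace ℝ (Fin d)) 𝓘(ℝ, E) (Subtype.val : Leaf π b → M) q u)
    (mfderiv 𝓘(ℝ, EuclideanSpace ℝ (Fin d)) 𝓘(ℝ, E) (Subtype.val : Leaf π b → M) q w)

end Fibration

end PoissonGravity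

end

/-! Everything rests on how `L_v S` depends on `S` and on `v`. At a point `p` it involves `S` at `p`
and the derivative of `S` along `v`; if `v` is tangent to the leaf, only the values of `S` on that
leaf matter.

If the leaves are coisotropic, each `v_f` with `f` a function on `B` is tangent to the leaves, so
compatibility can be checked one leaf at a time: this is (b) ⇒ (a),
`leafMetricsIndependent_of_isCoisotropicLeaf`. Conversely, `exp(g ∘ π) S` is on each leaf a constant
multiple of `S`, hence leafwise compatible. Under (a) it is compatible, and the Leibniz rule leaves
`v_f(g ∘ π) S = 0`. As `S` vanishes nowhere, `v_f(g ∘ π) = 0` for all `f`, `g`, which is coisotropy: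
`isCoisotropicLeaf_of_leafMetricsIndependent`.

For part 2, `ker S♯` is the conormal space, so its elements are differentials of functions `f ∘ π`.
The fields `v_f` preserve `S` and are tangent to the leaf, so they restrict to Killing fields with
prescribed value in `P♯(ker S♯)`: `isKillingField_of_lift` and `exists_isKillingField`. Inverting
`S` to a metric is done in coordinates, through the Gram matrix `S(dx_i, dx_j)`. -/

noncomputable section

namespace PoissonGravity

open scoped Topology

/-! ### Differentials of functions, in charts and along fibres -/

section Calculus

variable {E : Type*} [NormedAddCommGroup E] [NormedSpace ℝ E]
  {M : Type*} [TopologicalSpace M] [ChartedSpace E M]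
  {F : Type*} [NormedAddCommGroup F] [NormedSpace ℝ F]
  {B : Type*} [TopologicalSpace B] [ChartedSpace F B]

theorem dAt_mul {f g : M → ℝ} {p : M} (hf : MDifferentiableAt 𝓘(ℝ, E) 𝓘(ℝ, ℝ) f p)
    (hg : MDifferentiableAt 𝓘(ℝ, E) 𝓘(ℝ, ℝ) g p) (v : TangentSpace 𝓘(ℝ, E) p) :
    dAt (E := E) (fun q ↦ f q * g q) p v
      = f p * dAt (E := E) g p v + g p * dAt (E := E) f p v :=
  congrArg (fun L : TangentSpace 𝓘(ℝ, E) p →L[ℝ] ℝ ↦ L v)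
    (hf.hasMFDerivAt.mul hg.hasMFDerivAt).mfderiv

theorem dAt_sub {f g : M → ℝ} {p : M} (hf : MDifferentiableAt 𝓘(ℝ, E) 𝓘(ℝ, ℝ) f p)
    (hg : MDifferentiableAt 𝓘(ℝ, E) 𝓘(ℝ, ℝ) g p) (v : TangentSpace 𝓘(ℝ, E) p) :
    dAt (E := E) (fun q ↦ f q - g q) p v = dAt (E := E) f p v - dAt (E := E) g p v :=
  congrArg (fun L : TangentSpace 𝓘(ℝ, E) p →L[ℝ] ℝ ↦ L v)
    (hf.hasMFDerivAt.sub hg.hasMFDerivAt).mfderiv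

theorem dAt_sum {ι : Type} {s : Finset ι} {f : ι → M → ℝ} {p : M}
    (hf : ∀ i ∈ s, MDifferentiableAt 𝓘(ℝ, E) 𝓘(ℝ, ℝ) (f i) p) (v : TangentSpace 𝓘(ℝ, E) p) :
    dAt (E := E) (fun q ↦ ∑ i ∈ s, f i q) p v = ∑ i ∈ s, dAt (E := E) (f i) p v := by
  have h := (HasMFDerivAt.sum fun i hi ↦ (hf i hi).hasMFDerivAt).mfderiv
  have e : (fun q ↦ ∑ i ∈ s, f i q) = ∑ i ∈ s, f i := by ext; simp
  rw [e]
  refine (congrArg (fun L : TangentSpace 𝓘(ℝ, E) p →L[ℝ] ℝ ↦ L v) h).trans ?_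
  exact sum_apply (F := E →L[ℝ] ℝ) (x := v) ..

theorem dAt_comp {f : B → ℝ} {h : M → B} {p : M}
    (hf : MDifferentiableAt 𝓘(ℝ, F) 𝓘(ℝ, ℝ) f (h p))
    (hh : MDifferentiableAt 𝓘(ℝ, E) 𝓘(ℝ, F) h p) (v : TangentSpace 𝓘(ℝ, E) p) :
    dAt (E := E) (fun q ↦ f (h q)) p v
      = dAt (E := F) f (h p) (mfderiv 𝓘(ℝ, E) 𝓘(ℝ, F) h p v) :=
  mfderiv_comp_apply p hf hh v

theorem dAt_congr {f g : M → ℝ} {p : M} (h : f =ᶠ[𝓝 p] g) :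
    dAt (E := E) f p = dAt (E := E) g p :=
  h.mfderiv_eq

theorem dAt_eq_fderiv {f : M → ℝ} {p : M} (hf : MDifferentiableAt 𝓘(ℝ, E) 𝓘(ℝ, ℝ) f p) :
    dAt (E := E) f p = fderiv ℝ (f ∘ (extChartAt 𝓘(ℝ, E) p).symm) (extChartAt 𝓘(ℝ, E) p p) := by
  refine hf.mfderiv.trans ?_
  change fderivWithin ℝ (f ∘ (extChartAt 𝓘(ℝ, E) p).symm) (Set.range id) _ = _
  rw [Set.range_id, fderivWithin_univ]

variable [IsManifold 𝓘(ℝ, E) ∞ M]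

/-- One fixed chart serves all nearby points `q`; the derivative of the chart enters because it is
the identity only at the centre `p`. -/
theorem dAt_eq_fderiv_chart {f : M → ℝ} {p q : M}
    (hq : q ∈ (chartAt E p).source) (hf : MDifferentiableAt 𝓘(ℝ, E) 𝓘(ℝ, ℝ) f q)
    (v : TangentSpace 𝓘(ℝ, E) q) :
    dAt (E := E) f q v = fderiv ℝ (f ∘ (extChartAt 𝓘(ℝ, E) p).symm) (extChartAt 𝓘(ℝ, E) p q)
      (mfderiv 𝓘(ℝ, E) 𝓘(ℝ, E) (extChartAt 𝓘(ℝ, E) p) q v) := by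
  have hq' : q ∈ (extChartAt 𝓘(ℝ, E) p).source := by simpa using hq
  have hM : IsManifold 𝓘(ℝ, E) 1 M := IsManifold.of_le (n := ∞) (by norm_num)
  have hs : MDifferentiableAt 𝓘(ℝ, E) 𝓘(ℝ, E) (extChartAt 𝓘(ℝ, E) p).symm
      (extChartAt 𝓘(ℝ, E) p q) := by
    have := mdifferentiableWithinAt_extChartAt_symm (I := 𝓘(ℝ, E)) (x := p)
      ((extChartAt 𝓘(ℝ, E) p).map_source hq')
    rwa [ModelWithCorners.range_eq_univ, mdifferentiableWithinAt_univ] at this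
  have e : (extChartAt 𝓘(ℝ, E) p).symm (extChartAt 𝓘(ℝ, E) p q) = q :=
    (extChartAt 𝓘(ℝ, E) p).left_inv hq'
  have hc : MDifferentiableAt 𝓘(ℝ, E) 𝓘(ℝ, ℝ) (f ∘ (extChartAt 𝓘(ℝ, E) p).symm)
      (extChartAt 𝓘(ℝ, E) p q) := MDifferentiableAt.comp _ (by rwa [e]) hs
  have h1 : f =ᶠ[𝓝 q] fun r ↦ (f ∘ (extChartAt 𝓘(ℝ, E) p).symm) (extChartAt 𝓘(ℝ, E) p r) := by
    filter_upwards [(isOpen_extChartAt_source p).mem_nhds hq'] with r hr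
    exact congrArg f ((extChartAt 𝓘(ℝ, E) p).left_inv hr).symm
  rw [dAt_congr h1, dAt_comp hc (mdifferentiableAt_extChartAt hq)]
  exact congrArg (fun L : E →L[ℝ] ℝ ↦ L _) mfderiv_eq_fderiv

theorem contDiffAt_comp_extChartAt_symm {f : M → ℝ} {p q : M} (hq : q ∈ (chartAt E p).source)
    (hf : ContMDiffAt 𝓘(ℝ, E) 𝓘(ℝ, ℝ) ∞ f q) :
    ContDiffAt ℝ ∞ (f ∘ (extChartAt 𝓘(ℝ, E) p).symm) (extChartAt 𝓘(ℝ, E) p q) := by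
  have hq' : q ∈ (extChartAt 𝓘(ℝ, E) p).source := by simpa using hq
  have e : (extChartAt 𝓘(ℝ, E) p).symm (extChartAt 𝓘(ℝ, E) p q) = q :=
    (extChartAt 𝓘(ℝ, E) p).left_inv hq'
  have hs : ContMDiffAt 𝓘(ℝ, E) 𝓘(ℝ, E) ∞ (extChartAt 𝓘(ℝ, E) p).symm
      (extChartAt 𝓘(ℝ, E) p q) :=
    (contMDiffOn_extChartAt_symm p).contMDiffAt
      (extChartAt_target_mem_nhds' ((extChartAt 𝓘(ℝ, E) p).map_source hq'))
  exact (ContMDiffAt.comp _ (by rwa [e]) hs).contDiffAt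

/-- Every covector is the differential of a globally defined smooth function. -/
theorem exists_contMDiffMap_dAt_eq [FiniteDimensional ℝ E] [T2Space M] (p : M)
    (α : TangentSpace 𝓘(ℝ, E) p →L[ℝ] ℝ) :
    ∃ f : C^∞⟮𝓘(ℝ, E), M; ℝ⟯, dAt (E := E) f p = α := by
  obtain ⟨φ⟩ : Nonempty (SmoothBumpFunction 𝓘(ℝ, E) p) := inferInstance
  let β : E →L[ℝ] ℝ := α
  have h1 : ContMDiffOn 𝓘(ℝ, E) 𝓘(ℝ, ℝ) ∞ (fun q ↦ β (extChartAt 𝓘(ℝ, E) p q))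
      (chartAt E p).source :=
    β.contMDiff.comp_contMDiffOn contMDiffOn_extChartAt
  refine ⟨⟨_, φ.contMDiff_smul h1⟩, ?_⟩
  have h2 : (fun q ↦ φ q • β (extChartAt 𝓘(ℝ, E) p q)) =ᶠ[𝓝 p]
      fun q ↦ β (extChartAt 𝓘(ℝ, E) p q) := by
    filter_upwards [φ.eventuallyEq_one] with q hq
    simp [hq]
  have h3 : MDifferentiableAt 𝓘(ℝ, E) 𝓘(ℝ, ℝ) (fun q ↦ β (extChartAt 𝓘(ℝ, E) p q)) p :=
    ((h1 p (mem_chart_source E p)).contMDiffAt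
      ((chartAt E p).open_source.mem_nhds (mem_chart_source E p))).mdifferentiableAt (by simp)
  refine (dAt_congr h2).trans ((dAt_eq_fderiv h3).trans ?_)
  have h4 : ((fun q ↦ β (extChartAt 𝓘(ℝ, E) p q)) ∘ (extChartAt 𝓘(ℝ, E) p).symm)
      =ᶠ[𝓝 (extChartAt 𝓘(ℝ, E) p p)] β := by
    filter_upwards [extChartAt_target_mem_nhds (I := 𝓘(ℝ, E)) p] with y hy
    exact congrArg β ((extChartAt 𝓘(ℝ, E) p).right_inv hy)
  rw [h4.fderiv_eq]
  exact β.fderiv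

/-- A function vanishing on a fibre of a submersion has zero derivative along the fibre. -/
theorem dAt_eq_zero_of_eq_zero_on_fiber [CompleteSpace E] [CompleteSpace F]
    [IsManifold 𝓘(ℝ, F) ∞ B] {π : M → B} (hπ : ContMDiff 𝓘(ℝ, E) 𝓘(ℝ, F) ∞ π) {p : M}
    (hsub : Function.Surjective (mfderiv 𝓘(ℝ, E) 𝓘(ℝ, F) π p)) {h : M → ℝ}
    (hh : ContMDiff 𝓘(ℝ, E) 𝓘(ℝ, ℝ) ∞ h) (h0 : ∀ q, π q = π p → h q = 0)
    {v : TangentSpace 𝓘(ℝ, E) p} (hv : mfderiv 𝓘(ℝ, E) 𝓘(ℝ, F) π p v = 0) :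
    dAt (E := E) h p v = 0 := by
  set χ := extChartAt 𝓘(ℝ, E) p
  set ψ := extChartAt 𝓘(ℝ, F) (π p)
  let f : E → F := writtenInExtChartAt 𝓘(ℝ, E) 𝓘(ℝ, F) p π
  have hfd : mfderiv 𝓘(ℝ, E) 𝓘(ℝ, F) π p = fderiv ℝ f (χ p) := by
    refine ((hπ p).mdifferentiableAt (by simp)).mfderiv.trans ?_
    change fderivWithin ℝ f (Set.range id) _ = _
    rw [Set.range_id, fderivWithin_univ]
  have hf : ContDiffAt ℝ ∞ f (χ p) := by
    have := ((contMDiffAt_iff (I := 𝓘(ℝ, E)) (I' := 𝓘(ℝ, F))).1 (hπ p)).2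
    rwa [ModelWithCorners.range_eq_univ, contDiffWithinAt_univ] at this
  have hhc := contDiffAt_comp_extChartAt_symm (mem_chart_source E p) (hh p)
  have hhd := dAt_eq_fderiv ((hh p).mdifferentiableAt (by simp))
  have e0 : χ.symm (χ p) = p := extChartAt_to_inv p
  -- Lagrange multipliers: `h` is constant on the fibre, so `p` is a constrained extremum.
  -- Surjectivity of `dπ` makes the multiplier `c` of `dh` nonzero, and on `ker dπ` only the term `c
  -- dh` is left.
  have hext : IsLocalExtrOn (h ∘ χ.symm) {y | f y = f (χ p)} (χ p) := by
    left
    have hc : ContinuousAt (fun y ↦ π (χ.symm y)) (χ p) := by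
      refine ContinuousAt.comp ?_ (continuousAt_extChartAt_symm p)
      exact (hπ _).continuousAt
    have hm : ∀ᶠ y in 𝓝 (χ p), π (χ.symm y) ∈ ψ.source :=
      hc.preimage_mem_nhds (by
        rw [e0]; exact extChartAt_source_mem_nhds (I := 𝓘(ℝ, F)) (π p))
    refine eventually_nhdsWithin_iff.2 ?_
    filter_upwards [hm] with y hy hfy
    have hfy' : ψ (π (χ.symm y)) = ψ (π p) := by
      simpa [f, writtenInExtChartAt, χ, ψ] using hfy
    have := ψ.injOn hy (mem_extChartAt_source (π p)) hfy'
    simp [h0 _ this, e0, h0 p rfl]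
  obtain ⟨Λ, c, hne, hΛ⟩ := hext.exists_linear_map_of_hasStrictFDerivAt
    (hf.hasStrictFDerivAt (by simp)) (hhc.hasStrictFDerivAt (by simp))
  have hc : c ≠ 0 := by
    rintro rfl
    apply hne
    have : Λ = 0 := by
      ext w
      obtain ⟨u, hu⟩ := hsub w
      have h1 := hΛ u
      have hu' : fderiv ℝ f (χ p) u = w := by rw [← hu, hfd]; rfl
      rw [hu'] at h1
      simpa using h1
    simp [this]
  have h1 := hΛ v
  have hv' : fderiv ℝ f (χ p) v = 0 := by rw [← hfd]; exact hv
  rw [hv', map_zero, zero_add] at h1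
  rw [hhd]
  exact (smul_eq_zero.1 h1).resolve_left hc

end Calculus

/-! ### Smooth vector fields and their brackets as derivations -/

section VectorFields

variable {E : Type*} [NormedAddCommGroup E] [NormedSpace ℝ E]
  {M : Type*} [TopologicalSpace M] [ChartedSpace E M] [IsManifold 𝓘(ℝ, E) ∞ M]

/-- The derivative of a smooth function along a smooth vector field is smooth. -/
theorem contMDiff_dAt_apply {f : M → ℝ} (hf : ContMDiff 𝓘(ℝ, E) 𝓘(ℝ, ℝ) ∞ f)
    {X : ∀ p : M, TangentSpace 𝓘(ℝ, E) p}
    (hX : ContMDiff 𝓘(ℝ, E) 𝓘(ℝ, E).tangent ∞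
      (fun p ↦ (⟨p, X p⟩ : TangentBundle 𝓘(ℝ, E) M))) :
    ContMDiff 𝓘(ℝ, E) 𝓘(ℝ, ℝ) ∞ (fun p ↦ dAt (E := E) f p (X p)) := by
  have h1 : ContMDiff 𝓘(ℝ, E).tangent 𝓘(ℝ, ℝ).tangent ∞ (tangentMap 𝓘(ℝ, E) 𝓘(ℝ, ℝ) f) :=
    hf.contMDiff_tangentMap (by simp)
  exact (contMDiff_snd_tangentBundle_modelSpace ℝ 𝓘(ℝ, ℝ)).comp (h1.comp hX)

/-- A vector field acting smoothly on a family of functions that are coordinates near `p`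
is smooth at `p`. -/
theorem contMDiffAt_vectorField_of_dAt [FiniteDimensional ℝ E] {ι : Type*} [Fintype ι]
    {x : ι → M → ℝ}
    (hx : ∀ i, ContMDiff 𝓘(ℝ, E) 𝓘(ℝ, ℝ) ∞ (x i)) {p : M}
    (hbij : Function.Bijective (fun (v : TangentSpace 𝓘(ℝ, E) p) i ↦ dAt (E := E) (x i) p v))
    {X : ∀ p : M, TangentSpace 𝓘(ℝ, E) p}
    (hX : ∀ i, ContMDiffAt 𝓘(ℝ, E) 𝓘(ℝ, ℝ) ∞ (fun q ↦ dAt (E := E) (x i) q (X q)) p) :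
    ContMDiffAt 𝓘(ℝ, E) 𝓘(ℝ, E).tangent ∞
      (fun p ↦ (⟨p, X p⟩ : TangentBundle 𝓘(ℝ, E) M)) p := by
  have hM : IsManifold 𝓘(ℝ, E) 1 M := IsManifold.of_le (n := ∞) (by norm_num)
  set φ := extChartAt 𝓘(ℝ, E) p with hφ
  have hsrc : ∀ᶠ q in 𝓝 p, q ∈ (chartAt E p).source :=
    (chartAt E p).open_source.mem_nhds (mem_chart_source E p)
  -- In the chart, `H` is the coordinate change given by the `x i`. Its derivative is invertible
  -- near `p`, and applying the inverse to the smooth functions `dx_i(X)` recovers the components of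
  -- `X`.
  let H : E → (ι → ℝ) := fun y i ↦ (x i ∘ φ.symm) y
  have hH : ∀ q ∈ (chartAt E p).source, ContDiffAt ℝ ∞ H (φ q) := fun q hq ↦
    contDiffAt_pi.2 fun i ↦ contDiffAt_comp_extChartAt_symm hq (hx i q)
  have key : ∀ q ∈ (chartAt E p).source, ∀ v : TangentSpace 𝓘(ℝ, E) q,
      fderiv ℝ H (φ q) (mfderiv 𝓘(ℝ, E) 𝓘(ℝ, E) φ q v) = fun i ↦ dAt (E := E) (x i) q v := by
    intro q hq v
    have h1 : fderiv ℝ H (φ q)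
        = ContinuousLinearMap.pi fun i ↦ fderiv ℝ (x i ∘ φ.symm) (φ q) :=
      fderiv_pi fun i ↦
        (contDiffAt_comp_extChartAt_symm hq (hx i q)).differentiableAt (by simp)
    rw [h1]
    funext i
    exact (dAt_eq_fderiv_chart hq ((hx i q).mdifferentiableAt (by simp)) v).symm
  have hinv : (fderiv ℝ H (φ p)).IsInvertible := by
    have hb : Function.Bijective (fderiv ℝ H (φ p)) := by
      have h2 : (fun v : E ↦ fderiv ℝ H (φ p) v)
          = fun (v : TangentSpace 𝓘(ℝ, E) p) i ↦ dAt (E := E) (x i) p v := by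
        funext v
        refine Eq.trans ?_ (key p (mem_chart_source E p) v)
        rw [hφ, mfderiv_extChartAt_self]
        rfl
      change Function.Bijective (fun v : E ↦ fderiv ℝ H (φ p) v)
      rw [h2]
      exact hbij
    exact ⟨(LinearEquiv.ofBijective (fderiv ℝ H (φ p)).toLinearMap hb).toContinuousLinearEquiv,
      by ext; rfl⟩
  have hfd : ContMDiffAt 𝓘(ℝ, E) 𝓘(ℝ, E →L[ℝ] (ι → ℝ)) ∞ (fun q ↦ fderiv ℝ H (φ q)) p := by
    have h3 : ContDiffAt ℝ ∞ (fderiv ℝ H) (φ p) :=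
      (hH p (mem_chart_source E p)).fderiv_right (by simp)
    exact h3.contMDiffAt.comp p (contMDiffAt_extChartAt (I := 𝓘(ℝ, E)))
  have hfi : ContMDiffAt 𝓘(ℝ, E) 𝓘(ℝ, (ι → ℝ) →L[ℝ] E) ∞
      (fun q ↦ (fderiv ℝ H (φ q)).inverse) p :=
    (hinv.contDiffAt_map_inverse (n := ∞)).contMDiffAt.comp p hfd
  have hev : ∀ᶠ q in 𝓝 p, (fderiv ℝ H (φ q)).IsInvertible := by
    obtain ⟨e, he⟩ := hinv
    exact hfd.continuousAt (he ▸ e.nhds)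
  have hd : ContMDiffAt 𝓘(ℝ, E) 𝓘(ℝ, ι → ℝ) ∞
      (fun q i ↦ dAt (E := E) (x i) q (X q)) p := contMDiffAt_pi_space.2 hX
  rw [Bundle.contMDiffAt_section]
  refine (hfi.clm_apply hd).congr_of_eventuallyEq ?_
  filter_upwards [hsrc, hev] with q hq hi
  have h5 := TangentBundle.continuousLinearMapAt_trivializationAt (I := 𝓘(ℝ, E)) hq
  have h6 : (trivializationAt E (TangentSpace 𝓘(ℝ, E)) p ⟨q, X q⟩).2
      = mfderiv 𝓘(ℝ, E) 𝓘(ℝ, E) φ q (X q) := by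
    have h7 : (trivializationAt E (TangentSpace 𝓘(ℝ, E)) p).continuousLinearMapAt ℝ q (X q)
        = (trivializationAt E (TangentSpace 𝓘(ℝ, E)) p ⟨q, X q⟩).2 := by
      rw [Bundle.Trivialization.continuousLinearMapAt_apply,
        Bundle.Trivialization.coe_linearMapAt_of_mem]
      simpa using hq
    rw [← h7]
    exact congrArg (fun L : TangentSpace 𝓘(ℝ, E) q →L[ℝ] E ↦ L (X q)) h5
  rw [← key q hq]
  exact h6.trans (hi.inverse_apply_self (mfderiv 𝓘(ℝ, E) 𝓘(ℝ, E) φ q (X q) : E)).symm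

/-- The Lie bracket acts on functions as the commutator. -/
theorem dAt_mlieBracket [CompleteSpace E] {f : M → ℝ} (hf : ContMDiff 𝓘(ℝ, E) 𝓘(ℝ, ℝ) ∞ f)
    {X Y : ∀ p : M, TangentSpace 𝓘(ℝ, E) p}
    (hX : ContMDiff 𝓘(ℝ, E) 𝓘(ℝ, E).tangent ∞ (fun p ↦ (⟨p, X p⟩ : TangentBundle 𝓘(ℝ, E) M)))
    (hY : ContMDiff 𝓘(ℝ, E) 𝓘(ℝ, E).tangent ∞ (fun p ↦ (⟨p, Y p⟩ : TangentBundle 𝓘(ℝ, E) M)))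
    (p : M) :
    dAt (E := E) f p (VectorField.mlieBracket 𝓘(ℝ, E) X Y p)
      = dAt (E := E) (fun q ↦ dAt (E := E) f q (Y q)) p (X p)
        - dAt (E := E) (fun q ↦ dAt (E := E) f q (X q)) p (Y p) := by
  have hM : IsManifold 𝓘(ℝ, E) 1 M := IsManifold.of_le (n := ∞) (by norm_num)
  have hM2 : IsManifold 𝓘(ℝ, E) 2 M :=
    IsManifold.of_le (n := ∞) (by norm_cast)
  set φ := extChartAt 𝓘(ℝ, E) p with hφ
  -- The manifold bracket is defined through these pullbacks to the model space, where the
  -- commutator identity is `VectorField.fderiv_apply_lieBracket`.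
  let pull : (∀ p : M, TangentSpace 𝓘(ℝ, E) p) → E → E := fun V ↦
    VectorField.mpullbackWithin 𝓘(ℝ, E) 𝓘(ℝ, E) φ.symm V (Set.range 𝓘(ℝ, E))
  have hpull : ∀ V : (∀ p : M, TangentSpace 𝓘(ℝ, E) p), ∀ y ∈ φ.target,
      pull V y = mfderiv 𝓘(ℝ, E) 𝓘(ℝ, E) φ (φ.symm y) (V (φ.symm y)) := by
    intro V y hy
    have h1 := mfderiv_extChartAt_comp_mfderivWithin_extChartAt_symm (I := 𝓘(ℝ, E)) hy
    have h2 := mfderivWithin_extChartAt_symm_comp_mfderiv_extChartAt (I := 𝓘(ℝ, E)) hy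
    change (mfderivWithin 𝓘(ℝ, E) 𝓘(ℝ, E) φ.symm (Set.range 𝓘(ℝ, E)) y).inverse _ = _
    rw [ContinuousLinearMap.inverse_eq h2 h1]
    rfl
  have hder : ∀ V : (∀ p : M, TangentSpace 𝓘(ℝ, E) p), ∀ y ∈ φ.target,
      fderiv ℝ (f ∘ φ.symm) y (pull V y) = dAt (E := E) f (φ.symm y) (V (φ.symm y)) := by
    intro V y hy
    have hq : φ.symm y ∈ (chartAt E p).source := by
      simpa [hφ] using φ.map_target hy
    rw [dAt_eq_fderiv_chart hq ((hf _).mdifferentiableAt (by simp)), hpull V y hy,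
      ← hφ, φ.right_inv hy]
  have hdiff : ∀ V : (∀ p : M, TangentSpace 𝓘(ℝ, E) p),
      ContMDiff 𝓘(ℝ, E) 𝓘(ℝ, E).tangent ∞ (fun p ↦ (⟨p, V p⟩ : TangentBundle 𝓘(ℝ, E) M)) →
      DifferentiableAt ℝ (pull V) (φ p) := by
    intro V hV
    have h3 := ((hV p).mdifferentiableAt
      (by simp)).mdifferentiableWithinAt (s := Set.univ)
      |>.differentiableWithinAt_mpullbackWithin_vectorField
    have h4 : DifferentiableWithinAt ℝ (pull V) (φ.symm ⁻¹' Set.univ ∩ Set.range id) (φ p) := h3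
    rwa [Set.preimage_univ, Set.univ_inter, Set.range_id, differentiableWithinAt_univ] at h4
  have hscal : ∀ V W : (∀ p : M, TangentSpace 𝓘(ℝ, E) p),
      ContMDiff 𝓘(ℝ, E) 𝓘(ℝ, E).tangent ∞ (fun p ↦ (⟨p, V p⟩ : TangentBundle 𝓘(ℝ, E) M)) →
      dAt (E := E) (fun q ↦ dAt (E := E) f q (V q)) p (W p)
        = fderiv ℝ (fun y ↦ fderiv ℝ (f ∘ φ.symm) y (pull V y)) (φ p) (pull W (φ p)) := by
    intro V W hV
    have h4 : (fun y ↦ fderiv ℝ (f ∘ φ.symm) y (pull V y)) =ᶠ[𝓝 (φ p)]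
        (fun q ↦ dAt (E := E) f q (V q)) ∘ φ.symm := by
      filter_upwards [extChartAt_target_mem_nhds (I := 𝓘(ℝ, E)) p] with y hy
      exact hder V y hy
    rw [h4.fderiv_eq, hpull W _ (mem_extChartAt_target p),
      dAt_eq_fderiv_chart (mem_chart_source E p)
        ((contMDiff_dAt_apply hf hV p).mdifferentiableAt (by simp)), ← hφ, hφ,
      extChartAt_to_inv]
  rw [hscal Y X hY, hscal X Y hX, ← VectorField.fderiv_apply_lieBracket
    (contDiffAt_comp_extChartAt_symm (mem_chart_source E p) (hf p)) (by simp; norm_cast) (hdiff Y hY)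
    (hdiff X hX), dAt_eq_fderiv ((hf p).mdifferentiableAt (by simp))]
  congr 1
  have h5 : (mfderiv 𝓘(ℝ, E) 𝓘(ℝ, E) φ p : E →L[ℝ] E) = ContinuousLinearMap.id ℝ E :=
    mfderiv_extChartAt_self
  change (mfderiv 𝓘(ℝ, E) 𝓘(ℝ, E) φ p : E →L[ℝ] E).inverse (VectorField.lieBracketWithin ℝ (E := E)
    (pull X) (pull Y) (φ.symm ⁻¹' Set.univ ∩ Set.range id) (φ p)) = _
  rw [h5, Set.preimage_univ, Set.univ_inter, Set.range_id, VectorField.lieBracketWithin_univ]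
  exact congrArg (fun L : E →L[ℝ] E ↦ L _) ContinuousLinearMap.inverse_id

end VectorFields

/-! ### Leaf structures, and the equivalence of (a) and (b) -/

section LeafStructures

variable {E : Type*} [NormedAddCommGroup E] [NormedSpace ℝ E]
  {F : Type*} [NormedAddCommGroup F] [NormedSpace ℝ F]
  {M : Type*} [TopologicalSpace M] [ChartedSpace E M]
  {B : Type*} [TopologicalSpace B] [ChartedSpace F B]

instance (p : M) : SeparatingDual ℝ (TangentSpace 𝓘(ℝ, E) p) :=
  inferInstanceAs (SeparatingDual ℝ E)

/-- The tensor `lam S` for a smooth function `lam`. -/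
def ContraTensor.scale (lam : C^∞⟮𝓘(ℝ, E), M; ℝ⟯) (S : ContraTensor E M) : ContraTensor E M where
  sharp p := lam p • S.sharp p
  smooth f g := by
    have h : (fun p ↦ dAt (E := E) g p ((lam p • S.sharp p) (dAt f p)))
        = fun p ↦ lam p * dAt (E := E) g p (S.sharp p (dAt f p)) := by
      funext p
      exact (dAt (E := E) g p).map_smul (lam p) (S.sharp p (dAt f p))
    rw [h]
    exact lam.contMDiff.mul (S.smooth f g)

theorem ContraTensor.pair_scale (lam : C^∞⟮𝓘(ℝ, E), M; ℝ⟯) (S : ContraTensor E M) (p : M)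
    (α β : TangentSpace 𝓘(ℝ, E) p →L[ℝ] ℝ) :
    (S.scale lam).pair p α β = lam p * S.pair p α β :=
  β.map_smul (lam p) (S.sharp p α)

/-- When `S` is compatible only the last term survives, so compatibility of `lam S` detects whether
`v` kills `lam`. -/
theorem lieDeriv_scale (lam : C^∞⟮𝓘(ℝ, E), M; ℝ⟯) (S : ContraTensor E M)
    (v : ∀ p : M, TangentSpace 𝓘(ℝ, E) p) (g h : C^∞⟮𝓘(ℝ, E), M; ℝ⟯) (p : M) :
    lieDeriv v (S.scale lam) g h p
      = lam p * lieDeriv v S g h p + S.contract g h p * dAt (E := E) lam p (v p) := by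
  have e : dAt (E := E) ((S.scale lam).contract g h) p (v p)
      = lam p * dAt (E := E) (S.contract g h) p (v p)
        + S.contract g h p * dAt (E := E) lam p (v p) := by
    rw [← dAt_mul (lam.contMDiff.mdifferentiable (by simp) p)
      ((S.contract g h).contMDiff.mdifferentiable (by simp) p)]
    congr 2
    funext q
    exact S.pair_scale lam q _ _
  simp only [lieDeriv, e, ContraTensor.pair_scale]
  ring

theorem IsLeafStructure.scale {π : M → B} {S : ContraTensor E M} (hS : IsLeafStructure F π S)
    {lam : C^∞⟮𝓘(ℝ, E), M; ℝ⟯} (hlam : ∀ p, lam p ≠ 0) : IsLeafStructure F π (S.scale lam) where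
  symmetric p α β := by
    rw [ContraTensor.pair_scale, ContraTensor.pair_scale, hS.symmetric]
  image p := (LinearMap.range_smul (S.sharp p) (lam p) (hlam p)).trans (hS.image p)

/-- The covectors annihilating the image of `S♯` are in the kernel of `S♯`. -/
theorem IsLeafStructure.sharp_eq_zero {π : M → B} {S : ContraTensor E M}
    (hS : IsLeafStructure F π S) {p : M}
    {α : TangentSpace 𝓘(ℝ, E) p →L[ℝ] ℝ} (hα : ∀ u ∈ leafTangent E F π p, α u = 0) :
    S.sharp p α = 0 := by
  refine SeparatingDual.eq_zero_of_forall_dual_eq_zero (R := ℝ) fun β ↦ ?_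
  have h := hS.symmetric p α β
  exact h.trans (hα _ (hS.image p ▸ LinearMap.mem_range_self _ β))

/-- The covectors in the kernel of `S♯` annihilate the image of `S♯`. -/
theorem IsLeafStructure.apply_eq_zero {π : M → B} {S : ContraTensor E M}
    (hS : IsLeafStructure F π S) {p : M} {α : TangentSpace 𝓘(ℝ, E) p →L[ℝ] ℝ}
    (hα : S.sharp p α = 0) {u : TangentSpace 𝓘(ℝ, E) p} (hu : u ∈ leafTangent E F π p) :
    α u = 0 := by
  rw [← hS.image p] at hu
  obtain ⟨β, rfl⟩ := hu
  have h := hS.symmetric p β α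
  refine h.trans ?_
  rw [ContraTensor.pair, hα, map_zero]

theorem IsLeafStructure.sharp_mem {π : M → B} {S : ContraTensor E M}
    (hS : IsLeafStructure F π S) (p : M) (α : TangentSpace 𝓘(ℝ, E) p →L[ℝ] ℝ) :
    S.sharp p α ∈ leafTangent E F π p :=
  hS.image p ▸ LinearMap.mem_range_self _ α

/-- The covector chosen in `imageMetric` differs from `α` by an element of `ker S♯`, which
annihilates the leaf directions. -/
theorem IsLeafStructure.imageMetric_sharp {π : M → B} {S : ContraTensor E M}
    (hS : IsLeafStructure F π S) {p : M} (α : TangentSpace 𝓘(ℝ, E) p →L[ℝ] ℝ)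
    {w : TangentSpace 𝓘(ℝ, E) p} (hw : w ∈ leafTangent E F π p) :
    imageMetric S p (S.sharp p α) w = α w := by
  have h : ∃ β : TangentSpace 𝓘(ℝ, E) p →L[ℝ] ℝ, S.sharp p β = S.sharp p α := ⟨α, rfl⟩
  rw [imageMetric, dif_pos h]
  have h1 : (h.choose - α) w = 0 :=
    hS.apply_eq_zero (by rw [map_sub, h.choose_spec, sub_self]) hw
  exact sub_eq_zero.1 h1

/-- A metric determines its inverse: if `S♯ α = S'♯ β`, equality of the metrics makes `α` and `β`
agree on the leaf, so `β - α` lies in `ker S'♯`. -/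
theorem SameLeafMetric.sharp_eq {π : M → B} {S S' : ContraTensor E M} {b : B}
    (h : SameLeafMetric F π S S' b) (hS : IsLeafStructure F π S) (hS' : IsLeafStructure F π S')
    {p : M} (hp : π p = b) :
    S.sharp p = S'.sharp p := by
  ext α
  have hu := hS.sharp_mem p α
  obtain ⟨β, hβ⟩ : S.sharp p α ∈ LinearMap.range (S'.sharp p) := by rwa [hS'.image p]
  have h1 : S'.sharp p (β - α) = 0 := by
    refine hS'.sharp_eq_zero fun w hw ↦ ?_
    have h2 := h p hp _ hu w hw
    rw [hS.imageMetric_sharp α hw, ← hβ, hS'.imageMetric_sharp β hw] at h2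
    exact sub_eq_zero.2 h2.symm
  rw [← hβ]
  rw [map_sub] at h1
  exact sub_eq_zero.1 h1

theorem IsLeafFibration.mdifferentiableAt {π : M → B} {d : ℕ} (hπ : IsLeafFibration E F π d)
    (p : M) : MDifferentiableAt 𝓘(ℝ, E) 𝓘(ℝ, F) π p :=
  hπ.smooth.mdifferentiable (by simp) p

theorem IsCoisotropicLeaf.hamiltonianField_mem {P : ContraTensor E M} {π : M → B} {d : ℕ}
    (hπ : IsLeafFibration E F π d) {p : M} (h : IsCoisotropicLeaf F P π (π p))
    (f : C^∞⟮𝓘(ℝ, F), B; ℝ⟯) :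
    hamiltonianField P (fun q ↦ f (π q)) p ∈ leafTangent E F π p := by
  refine neg_mem (h p rfl _ fun u hu ↦ ?_)
  rw [dAt_comp (f.contMDiff.mdifferentiable (by simp) _) (hπ.mdifferentiableAt p)]
  have hu' : mfderiv 𝓘(ℝ, E) 𝓘(ℝ, F) π p u = 0 := hu
  rw [hu', map_zero]

variable [FiniteDimensional ℝ F] [IsManifold 𝓘(ℝ, F) ∞ B]

/-- A conormal covector of a leaf is the differential of a function on the leaf space. -/
theorem IsLeafFibration.exists_dAt_comp_eq [T2Space B] {π : M → B} {d : ℕ}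
    (hπ : IsLeafFibration E F π d) {p : M} {α : TangentSpace 𝓘(ℝ, E) p →L[ℝ] ℝ}
    (hα : ∀ u ∈ leafTangent E F π p, α u = 0) :
    ∃ f : C^∞⟮𝓘(ℝ, F), B; ℝ⟯, dAt (E := E) (fun q ↦ f (π q)) p = α := by
  let D := (mfderiv 𝓘(ℝ, E) 𝓘(ℝ, F) π p).toLinearMap
  obtain ⟨s, hs⟩ := D.exists_rightInverse_of_surjective
    (LinearMap.range_eq_top.2 (hπ.submersion p))
  -- Since `α` vanishes on `ker dπ`, it factors through `dπ`, and `β` is the factor.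
  let β : F →L[ℝ] ℝ := LinearMap.toContinuousLinearMap (α.toLinearMap ∘ₗ s : F →ₗ[ℝ] ℝ)
  obtain ⟨f, hf⟩ := exists_contMDiffMap_dAt_eq (E := F) (π p) β
  refine ⟨f, ?_⟩
  ext v
  rw [dAt_comp (f.contMDiff.mdifferentiable (by simp) _) (hπ.mdifferentiableAt p), hf]
  have h1 : D (s (D v)) = D v := LinearMap.congr_fun hs (D v)
  have h2 : α (s (D v) - v) = 0 := hα _ (by
    change D (s (D v) - v) = 0
    rw [map_sub, h1, sub_self])
  rw [map_sub] at h2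
  exact sub_eq_zero.1 h2

/-- Conormal covectors are differentials of functions from `B`, and tangency to the leaf means that
`dπ` of the vector is killed by every `dg`. -/
theorem isCoisotropicLeaf_of_dAt_eq_zero [T2Space B] {P : ContraTensor E M} {π : M → B} {d : ℕ}
    (hπ : IsLeafFibration E F π d)
    (h : ∀ (f g : C^∞⟮𝓘(ℝ, F), B; ℝ⟯) (p : M),
      dAt (E := E) (fun q ↦ g (π q)) p (hamiltonianField P (fun q ↦ f (π q)) p) = 0) (b : B) :
    IsCoisotropicLeaf F P π b := by
  intro p _ α hα
  obtain ⟨f, rfl⟩ := hπ.exists_dAt_comp_eq hα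
  change mfderiv 𝓘(ℝ, E) 𝓘(ℝ, F) π p (P.sharp p (dAt (fun q ↦ f (π q)) p)) = 0
  refine SeparatingDual.eq_zero_of_forall_dual_eq_zero (R := ℝ) fun β ↦ ?_
  obtain ⟨g, rfl⟩ := exists_contMDiffMap_dAt_eq (E := F) (π p) β
  rw [← dAt_comp (g.contMDiff.mdifferentiable (by simp) _) (hπ.mdifferentiableAt p)]
  have h1 := h f g p
  rw [hamiltonianField, map_neg, neg_eq_zero] at h1
  exact h1

variable [FiniteDimensional ℝ E] [IsManifold 𝓘(ℝ, E) ∞ M]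

/-- On the leaf through `p`, `S` agrees with a compatible `S'`. As `v` is tangent to that leaf, it
cannot distinguish `S(dg, dk)` from `S'(dg, dk)`, and the other terms of the Lie derivative use `S`
at `p` only. -/
theorem leafMetricsIndependent_of_isCoisotropicLeaf {P : ContraTensor E M} {π : M → B} {d : ℕ}
    (hπ : IsLeafFibration E F π d) (h : ∀ b, IsCoisotropicLeaf F P π b) :
    LeafMetricsIndependent F P π := by
  intro S hS hloc f g k p
  obtain ⟨S', hS', hc, hsame⟩ := hloc (π p)
  have hsharp : ∀ q, π q = π p → S.sharp q = S'.sharp q := fun q hq ↦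
    hsame.sharp_eq hS hS' hq
  have h1 := hc f g k p
  set v := hamiltonianField P (fun q ↦ f (π q))
  have hd : ∀ T : ContraTensor E M, ContMDiff 𝓘(ℝ, E) 𝓘(ℝ, ℝ) ∞ (T.contract g k) :=
    fun T ↦ (T.contract g k).contMDiff
  have h2 : dAt (E := E) (fun q ↦ S.contract g k q - S'.contract g k q) p (v p) = 0 := by
    refine dAt_eq_zero_of_eq_zero_on_fiber hπ.smooth (hπ.submersion p) ((hd S).sub (hd S'))
      (fun q hq ↦ ?_) ((h (π p)).hamiltonianField_mem hπ f)
    refine sub_eq_zero.2 ?_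
    change dAt (E := E) k q (S.sharp q (dAt g q)) = dAt (E := E) k q (S'.sharp q (dAt g q))
    rw [hsharp q hq]
  rw [dAt_sub ((hd S).mdifferentiable (by simp) p) ((hd S').mdifferentiable (by simp) p)] at h2
  rw [← h1, lieDeriv, lieDeriv, sub_eq_zero.1 h2]
  simp only [ContraTensor.pair, hsharp p rfl]

theorem isCoisotropicLeaf_of_leafMetricsIndependent [T2Space M] [T2Space B]
    {P S : ContraTensor E M} {π : M → B} {d : ℕ} (hd : 1 ≤ d) (hπ : IsLeafFibration E F π d)
    (hS : IsLeafStructure F π S) (hPS : IsCompatible F P π S)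
    (h : LeafMetricsIndependent F P π) (b : B) : IsCoisotropicLeaf F P π b := by
  refine isCoisotropicLeaf_of_dAt_eq_zero hπ (fun f g p ↦ ?_) b
  have hgm : ContMDiff 𝓘(ℝ, E) 𝓘(ℝ, ℝ) ∞ (fun q ↦ g (π q)) := g.contMDiff.comp hπ.smooth
  have hexp : ContMDiff 𝓘(ℝ, ℝ) 𝓘(ℝ, ℝ) ∞ Real.exp := Real.contDiff_exp.contMDiff
  -- The exponential keeps the factor nowhere zero, so the scaled tensor is again a leaf structure.
  let lam : C^∞⟮𝓘(ℝ, E), M; ℝ⟯ := ⟨fun q ↦ Real.exp (g (π q)), hexp.comp hgm⟩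
  have hcomp : IsCompatible F P π (S.scale lam) := by
    refine h _ (hS.scale fun q ↦ (Real.exp_pos _).ne') fun b ↦ ?_
    -- On the leaf over `b` the factor equals this constant, and constant multiples of `S` are
    -- compatible.
    let c : C^∞⟮𝓘(ℝ, E), M; ℝ⟯ := ⟨fun _ ↦ Real.exp (g b), contMDiff_const⟩
    refine ⟨S.scale c, hS.scale fun q ↦ (Real.exp_pos _).ne', fun f g h p ↦ ?_, ?_⟩
    · have hc : dAt (E := E) c p = 0 := mfderiv_const
      rw [lieDeriv_scale, hPS, hc]
      simp
    · rintro p rfl u - w -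
      rfl
  -- Here `d ≥ 1` enters: the image of `S♯` has dimension `d`, so `S` is nonzero at `p`.
  obtain ⟨α, hα⟩ : ∃ α, S.sharp p α ≠ 0 := by
    by_contra! h0
    have h1 := hπ.dim p
    rw [← hS.image p, LinearMap.range_eq_bot.2 (LinearMap.ext h0), finrank_bot] at h1
    omega
  obtain ⟨β, hβ⟩ := SeparatingDual.exists_ne_zero (R := ℝ) hα
  obtain ⟨x, rfl⟩ := exists_contMDiffMap_dAt_eq (E := E) p α
  obtain ⟨y, rfl⟩ := exists_contMDiffMap_dAt_eq (E := E) p β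
  have h2 := hcomp f x y p
  rw [lieDeriv_scale, hPS, mul_zero, zero_add] at h2
  have h3 := (mul_eq_zero.1 h2).resolve_left hβ
  have h4 := dAt_comp (f := Real.exp) (h := fun q ↦ g (π q)) (p := p)
    (hexp.mdifferentiable (by simp) _) (hgm.mdifferentiable (by simp) p)
    (hamiltonianField P (fun q ↦ f (π q)) p)
  have h5 : dAt (E := ℝ) Real.exp (g (π p)) = ContinuousLinearMap.toSpanSingleton ℝ
      (Real.exp (g (π p))) :=
    mfderiv_eq_fderiv.trans (Real.hasDerivAt_exp _).hasFDerivAt.fderiv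
  rw [h5] at h4
  have h6 := h4.symm.trans h3
  exact (mul_eq_zero.1 h6).resolve_right (Real.exp_pos _).ne'

end LeafStructures

/-! ### Linear systems with smooth coefficients -/

section LinearSystems

variable {E : Type*} [NormedAddCommGroup E] [NormedSpace ℝ E]
  {M : Type*} [TopologicalSpace M] [ChartedSpace E M]

/-- Cramer's rule with smooth dependence: a linear system that is regular at `p` is regular
near `p`, with a solution that is smooth at `p`. -/
theorem exists_contMDiffAt_solution {ι : Type*} [Fintype ι] [DecidableEq ι]
    {σ : ι → ι → M → ℝ} {y : ι → M → ℝ} {p : M}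
    (hσ : ∀ i j, ContMDiffAt 𝓘(ℝ, E) 𝓘(ℝ, ℝ) ∞ (σ i j) p)
    (hy : ∀ j, ContMDiffAt 𝓘(ℝ, E) 𝓘(ℝ, ℝ) ∞ (y j) p)
    (hinj : ∀ c : ι → ℝ, (∀ j, ∑ i, c i * σ i j p = 0) → c = 0) :
    ∃ u : ι → M → ℝ, (∀ i, ContMDiffAt 𝓘(ℝ, E) 𝓘(ℝ, ℝ) ∞ (u i) p) ∧
      ∀ᶠ q in 𝓝 p, (∀ j, ∑ i, u i q * σ i j q = y j q) ∧
        ∀ z : ι → ℝ, ∃ c : ι → ℝ, ∀ j, ∑ i, c i * σ i j q = z j := by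
  -- Expanding `A` in matrix units makes it visibly smooth in `q`; inversion is smooth on the open
  -- set of invertible maps.
  let unit : ι → ι → (ι → ℝ) →L[ℝ] (ι → ℝ) := fun i j ↦
    (ContinuousLinearMap.single ℝ (fun _ : ι ↦ ℝ) j).comp (ContinuousLinearMap.proj i)
  let A : M → (ι → ℝ) →L[ℝ] (ι → ℝ) := fun q ↦ ∑ i, ∑ j, σ i j q • unit i j
  have hA : ∀ q c j, A q c j = ∑ i, c i * σ i j q := by
    intro q c j
    simp [A, unit, Pi.single_apply, mul_comm]
  have hAs : ContMDiffAt 𝓘(ℝ, E) 𝓘(ℝ, (ι → ℝ) →L[ℝ] (ι → ℝ)) ∞ A p :=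
    ContMDiffAt.sum fun i _ ↦ ContMDiffAt.sum fun j _ ↦ (hσ i j).smul contMDiffAt_const
  have hAinj : Function.Injective (A p).toLinearMap := by
    refine (injective_iff_map_eq_zero _).2 fun c hc ↦ hinj c fun j ↦ ?_
    rw [← hA]
    exact congrFun hc j
  have hAinv : (A p).IsInvertible :=
    ⟨(LinearEquiv.ofInjectiveEndo _ hAinj).toContinuousLinearEquiv, by ext; rfl⟩
  have hev : ∀ᶠ q in 𝓝 p, (A q).IsInvertible := by
    obtain ⟨e, he⟩ := hAinv
    exact hAs.continuousAt (he ▸ e.nhds)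
  have hi : ContMDiffAt 𝓘(ℝ, E) 𝓘(ℝ, (ι → ℝ) →L[ℝ] (ι → ℝ)) ∞ (fun q ↦ (A q).inverse) p :=
    (hAinv.contDiffAt_map_inverse (n := ∞)).contMDiffAt.comp p hAs
  have hys : ContMDiffAt 𝓘(ℝ, E) 𝓘(ℝ, ι → ℝ) ∞ (fun q j ↦ y j q) p := contMDiffAt_pi_space.2 hy
  refine ⟨fun i q ↦ (A q).inverse (fun j ↦ y j q) i,
    contMDiffAt_pi_space.1 (hi.clm_apply hys), ?_⟩
  filter_upwards [hev] with q hq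
  refine ⟨fun j ↦ ?_, fun z ↦ ⟨(A q).inverse z, fun j ↦ ?_⟩⟩
  · rw [← hA, hq.self_apply_inverse]
  · rw [← hA, hq.self_apply_inverse]

end LinearSystems

/-! ### The Gram matrix of a leaf structure -/

section GramMatrix

variable {E : Type*} [NormedAddCommGroup E] [NormedSpace ℝ E]
  {F : Type*} [NormedAddCommGroup F] [NormedSpace ℝ F]
  {M : Type*} [TopologicalSpace M] [ChartedSpace E M]
  {B : Type*} [TopologicalSpace B] [ChartedSpace F B]

theorem ContraTensor.pair_sum (S : ContraTensor E M) (p : M) {ι : Type*} [Fintype ι] (c : ι → ℝ)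
    (α : ι → TangentSpace 𝓘(ℝ, E) p →L[ℝ] ℝ) (β : TangentSpace 𝓘(ℝ, E) p →L[ℝ] ℝ) :
    β (S.sharp p (∑ i, c i • α i)) = ∑ i, c i * S.pair p (α i) β := by
  simp [ContraTensor.pair]

/-- If the Gram matrix `S(dx_i, dx_j)` is regular, a vector tangent to the leaf is determined by
the `dx_j`. -/
theorem eq_sharp_sum_of_gram {π : M → B} {S : ContraTensor E M} {d : ℕ}
    (hS : IsLeafStructure F π S) {p : M} (hdim : Module.finrank ℝ (leafTangent E F π p) = d)
    (hd : 1 ≤ d) {α : Fin d → TangentSpace 𝓘(ℝ, E) p →L[ℝ] ℝ}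
    (hsurj : ∀ z : Fin d → ℝ, ∃ c : Fin d → ℝ, ∀ j, ∑ i, c i * S.pair p (α i) (α j) = z j)
    {u : TangentSpace 𝓘(ℝ, E) p} (hu : u ∈ leafTangent E F π p) {c : Fin d → ℝ}
    (hc : ∀ j, ∑ i, c i * S.pair p (α i) (α j) = α j u) :
    u = S.sharp p (∑ i, c i • α i) := by
  -- `finrank` is `0` in infinite dimension, so `d ≥ 1` forces finite dimension.
  have : FiniteDimensional ℝ (leafTangent E F π p) := Module.finite_of_finrank_pos (by omega)
  let Φ : leafTangent E F π p →ₗ[ℝ] (Fin d → ℝ) :=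
    (LinearMap.pi fun j ↦ (α j).toLinearMap) ∘ₗ (leafTangent E F π p).subtype
  -- Regularity of the Gram matrix makes the `α j` surjective on the tangent space of the leaf;
  -- equality of dimensions then gives injectivity.
  have hΦ : Function.Surjective Φ := by
    intro z
    obtain ⟨e, he⟩ := hsurj z
    refine ⟨⟨_, hS.sharp_mem p (∑ i, e i • α i)⟩, funext fun j ↦ ?_⟩
    exact (S.pair_sum p e α (α j)).trans (he j)
  have hΦi : Function.Injective Φ :=
    (LinearMap.injective_iff_surjective_of_finrank_eq_finrank (by simp [hdim])).2 hΦ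
  have h : Φ ⟨u, hu⟩ = Φ ⟨_, hS.sharp_mem p (∑ i, c i • α i)⟩ := by
    funext j
    exact (hc j).symm.trans (S.pair_sum p c α (α j)).symm
  exact congrArg Subtype.val (hΦi h)

end GramMatrix

/-! ### Restriction from `M` to a leaf -/

section Restriction

variable {E : Type*} [NormedAddCommGroup E] [NormedSpace ℝ E]
  {M : Type*} [TopologicalSpace M] [ChartedSpace E M]
  {B : Type*} {π : M → B} {b : B} {d : ℕ}
  [ChartedSpace (EuclideanSpace ℝ (Fin d)) (Leaf π b)]

variable (E) in
/-- The derivative of the inclusion of a leaf. -/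
def leafInclDeriv (q : Leaf π b) :
    TangentSpace 𝓘(ℝ, EuclideanSpace ℝ (Fin d)) q →L[ℝ] TangentSpace 𝓘(ℝ, E) q.1 :=
  mfderiv 𝓘(ℝ, EuclideanSpace ℝ (Fin d)) 𝓘(ℝ, E) (Subtype.val : Leaf π b → M) q

namespace IsLeafSubmanifold

theorem dAt_restrict (hR : IsLeafSubmanifold E π b d) {f : M → ℝ}
    (hf : ContMDiff 𝓘(ℝ, E) 𝓘(ℝ, ℝ) ∞ f) (q : Leaf π b)
    (w : TangentSpace 𝓘(ℝ, EuclideanSpace ℝ (Fin d)) q) :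
    dAt (E := EuclideanSpace ℝ (Fin d)) (fun q' : Leaf π b ↦ f q'.1) q w
      = dAt (E := E) f q.1 (leafInclDeriv E q w) :=
  dAt_comp (hf.mdifferentiable (by simp) _) (hR.smooth.mdifferentiable (by simp) q) w

section Ambient

variable [FiniteDimensional ℝ E] [IsManifold 𝓘(ℝ, E) ∞ M] [T2Space M]

/-- There are functions on the ambient manifold restricting to coordinates of the leaf at `q`. -/
theorem exists_coordinates (hR : IsLeafSubmanifold E π b d) (q : Leaf π b) :
    ∃ x : Fin d → C^∞⟮𝓘(ℝ, E), M; ℝ⟯, ∀ (w : EuclideanSpace ℝ (Fin d)) (i : Fin d),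
      dAt (E := E) (x i) q.1 (leafInclDeriv E q w) = w i := by
  let D : EuclideanSpace ℝ (Fin d) →ₗ[ℝ] E := (leafInclDeriv E q).toLinearMap
  obtain ⟨L, hL⟩ := D.exists_leftInverse_of_injective
    (LinearMap.ker_eq_bot.2 (hR.immersion q))
  choose x hx using fun i : Fin d ↦ exists_contMDiffMap_dAt_eq (E := E) q.1
    ((EuclideanSpace.proj i : EuclideanSpace ℝ (Fin d) →L[ℝ] ℝ).comp
      (LinearMap.toContinuousLinearMap L) : E →L[ℝ] ℝ)
  refine ⟨x, fun w i ↦ ?_⟩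
  rw [hx]
  exact congrArg (fun z : EuclideanSpace ℝ (Fin d) ↦ z i) (LinearMap.congr_fun hL w)

/-- A vector field on a leaf is smooth if it is the restriction of a derivation. -/
theorem contMDiff_of_lift (hR : IsLeafSubmanifold E π b d)
    [IsManifold 𝓘(ℝ, EuclideanSpace ℝ (Fin d)) ∞ (Leaf π b)]
    {v : ∀ p : M, TangentSpace 𝓘(ℝ, E) p}
    (hv : ∀ f : C^∞⟮𝓘(ℝ, E), M; ℝ⟯, ContMDiff 𝓘(ℝ, E) 𝓘(ℝ, ℝ) ∞ (fun p ↦ dAt (E := E) f p (v p)))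
    {X : ∀ q : Leaf π b, TangentSpace 𝓘(ℝ, EuclideanSpace ℝ (Fin d)) q}
    (hX : ∀ q, leafInclDeriv E q (X q) = v q.1) :
    ContMDiff 𝓘(ℝ, EuclideanSpace ℝ (Fin d)) 𝓘(ℝ, EuclideanSpace ℝ (Fin d)).tangent ∞
      (fun q ↦ (⟨q, X q⟩ : TangentBundle 𝓘(ℝ, EuclideanSpace ℝ (Fin d)) (Leaf π b))) := by
  intro q
  obtain ⟨x, hx⟩ := hR.exists_coordinates q
  have hxs : ∀ i, ContMDiff 𝓘(ℝ, EuclideanSpace ℝ (Fin d)) 𝓘(ℝ, ℝ) ∞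
      (fun q' : Leaf π b ↦ x i q'.1) := fun i ↦ (x i).contMDiff.comp hR.smooth
  refine contMDiffAt_vectorField_of_dAt hxs ?_ fun i ↦ ?_
  · have h : (fun (w : TangentSpace 𝓘(ℝ, EuclideanSpace ℝ (Fin d)) q) (i : Fin d) ↦
        dAt (E := EuclideanSpace ℝ (Fin d)) (fun q' : Leaf π b ↦ x i q'.1) q w)
        = EuclideanSpace.equiv (Fin d) ℝ := by
      funext w i
      exact (hR.dAt_restrict (x i).contMDiff q w).trans (hx w i)
    rw [h]
    exact (EuclideanSpace.equiv (Fin d) ℝ).bijective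
  · have h : (fun q' ↦ dAt (E := EuclideanSpace ℝ (Fin d)) (fun q' : Leaf π b ↦ x i q'.1) q' (X q'))
        = fun q' ↦ dAt (E := E) (x i) q'.1 (v q'.1) := by
      funext q'
      rw [hR.dAt_restrict (x i).contMDiff, hX]
    rw [h]
    exact (ContMDiff.comp (hv (x i)) hR.smooth) q

end Ambient

variable {F : Type*} [NormedAddCommGroup F] [NormedSpace ℝ F] [TopologicalSpace B]
  [ChartedSpace F B]

theorem leafInclDeriv_mem (hR : IsLeafSubmanifold E π b d) (hπ : IsLeafFibration E F π d)
    (q : Leaf π b) (w : TangentSpace 𝓘(ℝ, EuclideanSpace ℝ (Fin d)) q) :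
    leafInclDeriv E q w ∈ leafTangent E F π q.1 := by
  have h1 := mfderiv_comp_apply q (hπ.mdifferentiableAt q.1)
    (hR.smooth.mdifferentiable (by simp) q) w
  have h2 : π ∘ (Subtype.val : Leaf π b → M) = fun _ ↦ b := funext fun q' ↦ q'.2
  rw [h2, mfderiv_const] at h1
  exact h1.symm

/-- The derivative of the inclusion is injective between spaces of the same dimension `d`; this lets
tangent fields on `M` descend to the leaf. -/
theorem exists_leafInclDeriv_eq (hR : IsLeafSubmanifold E π b d) (hπ : IsLeafFibration E F π d)
    (hd : 1 ≤ d) (q : Leaf π b) {u : TangentSpace 𝓘(ℝ, E) q.1}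
    (hu : u ∈ leafTangent E F π q.1) :
    ∃ w : TangentSpace 𝓘(ℝ, EuclideanSpace ℝ (Fin d)) q, leafInclDeriv E q w = u := by
  have hdim := hπ.dim q.1
  have : FiniteDimensional ℝ (leafTangent E F π q.1) := Module.finite_of_finrank_pos (by omega)
  let Φ : EuclideanSpace ℝ (Fin d) →ₗ[ℝ] leafTangent E F π q.1 :=
    LinearMap.codRestrict _ (leafInclDeriv (d := d) E q).toLinearMap fun w ↦
      hR.leafInclDeriv_mem hπ q w
  have hΦ : Function.Injective Φ := fun _ _ h ↦ hR.immersion q (congrArg Subtype.val h)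
  obtain ⟨w, hw⟩ := (LinearMap.injective_iff_surjective_of_finrank_eq_finrank
    (by rw [hdim]; simp)).1 hΦ ⟨u, hu⟩
  exact ⟨w, congrArg Subtype.val hw⟩

theorem leafMetric_eq (hR : IsLeafSubmanifold E π b d) (hπ : IsLeafFibration E F π d)
    {S : ContraTensor E M} (hS : IsLeafStructure F π S) {q : Leaf π b}
    {u : TangentSpace 𝓘(ℝ, EuclideanSpace ℝ (Fin d)) q}
    {α : TangentSpace 𝓘(ℝ, E) q.1 →L[ℝ] ℝ} (hu : leafInclDeriv E q u = S.sharp q.1 α)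
    (w : TangentSpace 𝓘(ℝ, EuclideanSpace ℝ (Fin d)) q) :
    leafMetric S π b d q u w = α (leafInclDeriv E q w) := by
  change imageMetric S q.1 (leafInclDeriv E q u) (leafInclDeriv E q w) = _
  rw [hu, hS.imageMetric_sharp α (hR.leafInclDeriv_mem hπ q w)]

theorem leafMetric_symm (hR : IsLeafSubmanifold E π b d) (hπ : IsLeafFibration E F π d)
    {S : ContraTensor E M} (hS : IsLeafStructure F π S) (q : Leaf π b)
    (u w : TangentSpace 𝓘(ℝ, EuclideanSpace ℝ (Fin d)) q) :
    leafMetric S π b d q u w = leafMetric S π b d q w u := by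
  obtain ⟨α, hα⟩ : leafInclDeriv E q u ∈ LinearMap.range (S.sharp q.1) :=
    hS.image q.1 ▸ hR.leafInclDeriv_mem hπ q u
  obtain ⟨β, hβ⟩ : leafInclDeriv E q w ∈ LinearMap.range (S.sharp q.1) :=
    hS.image q.1 ▸ hR.leafInclDeriv_mem hπ q w
  rw [hR.leafMetric_eq hπ hS hα.symm, hR.leafMetric_eq hπ hS hβ.symm, ← hα, ← hβ]
  exact hS.symmetric q.1 β α

end IsLeafSubmanifold

end Restriction

/-! ### Symmetries of `S` restrict to Killing fields -/

section Killing

variable {E : Type*} [NormedAddCommGroup E] [NormedSpace ℝ E]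
  {F : Type*} [NormedAddCommGroup F] [NormedSpace ℝ F]
  {M : Type*} [TopologicalSpace M] [ChartedSpace E M]
  {B : Type*} [TopologicalSpace B] [ChartedSpace F B]
  {π : M → B} {b : B} {d : ℕ} [ChartedSpace (EuclideanSpace ℝ (Fin d)) (Leaf π b)]

/-- The Leibniz rule for `∑ i, u i * z i`, where `u` solves `∑ i, u i * σ i j = y j` and
`∑ j, w j * σ i j = z i`. -/
theorem sum_leibniz_solution {ι : Type*} [Fintype ι] (u w z u' z' y' : ι → ℝ)
    (σ σ₁ σ₂ : ι → ι → ℝ) (hz : ∀ i, z i = ∑ j, w j * σ i j)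
    (hy' : ∀ j, y' j = ∑ i, (u i * (σ₁ i j + σ₂ i j) + σ i j * u' i)) :
    ∑ i, (u i * z' i + z i * u' i) = ∑ j, w j * (y' j - ∑ i, u i * σ₂ i j)
      + ∑ i, u i * (z' i - ∑ j, w j * σ₁ i j) := by
  -- Inserting `hy'` cancels `σ₂`; the `σ₁` terms left over cancel against the second sum of the
  -- claim.
  have h1 : ∑ j, w j * (y' j - ∑ i, u i * σ₂ i j)
      = ∑ i, ∑ j, (w j * σ i j * u' i + w j * (u i * σ₁ i j)) := by
    rw [Finset.sum_comm]
    refine Finset.sum_congr rfl fun j _ ↦ ?_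
    rw [hy', ← Finset.sum_sub_distrib, Finset.mul_sum]
    exact Finset.sum_congr rfl fun i _ ↦ by ring
  rw [h1, ← Finset.sum_add_distrib]
  refine Finset.sum_congr rfl fun i _ ↦ ?_
  rw [hz, Finset.sum_add_distrib, mul_sub, Finset.mul_sum, Finset.sum_mul]
  have h2 : ∑ j, w j * (u i * σ₁ i j) = ∑ j, u i * (w j * σ₁ i j) :=
    Finset.sum_congr rfl fun j _ ↦ by ring
  rw [h2]
  ring

variable [FiniteDimensional ℝ E] [IsManifold 𝓘(ℝ, E) ∞ M] [T2Space M]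

/-- A vector field on a leaf that is the restriction of a symmetry of `S` is a Killing field. -/
theorem IsLeafSubmanifold.isKillingField_of_lift (hR : IsLeafSubmanifold E π b d)
    [IsManifold 𝓘(ℝ, EuclideanSpace ℝ (Fin d)) ∞ (Leaf π b)]
    (hπ : IsLeafFibration E F π d) (hd : 1 ≤ d) {S : ContraTensor E M}
    (hS : IsLeafStructure F π S) {v : ∀ p : M, TangentSpace 𝓘(ℝ, E) p}
    (hv : ∀ f : C^∞⟮𝓘(ℝ, E), M; ℝ⟯, ContMDiff 𝓘(ℝ, E) 𝓘(ℝ, ℝ) ∞ (fun p ↦ dAt (E := E) f p (v p)))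
    (hL : ∀ (f g : C^∞⟮𝓘(ℝ, E), M; ℝ⟯) (p : M), lieDeriv v S f g p = 0)
    {X : ∀ q : Leaf π b, TangentSpace 𝓘(ℝ, EuclideanSpace ℝ (Fin d)) q}
    (hX : ∀ q, leafInclDeriv E q (X q) = v q.1) :
    IsKillingField (leafMetric S π b d) X := by
  have hXs := hR.contMDiff_of_lift hv hX
  refine ⟨hXs, fun Y Z hY hZ q ↦ ?_⟩
  obtain ⟨x, hx⟩ := hR.exists_coordinates q
  let α : Fin d → ∀ p : M, TangentSpace 𝓘(ℝ, E) p →L[ℝ] ℝ := fun i p ↦ dAt (x i) p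
  let xR : Fin d → Leaf π b → ℝ := fun i q' ↦ x i q'.1
  let σ : Fin d → Fin d → Leaf π b → ℝ := fun i j q' ↦ S.contract (x i) (x j) q'.1
  let V : Fin d → M → ℝ := fun i p ↦ dAt (E := E) (x i) p (v p)
  have hxR : ∀ i, ContMDiff 𝓘(ℝ, EuclideanSpace ℝ (Fin d)) 𝓘(ℝ, ℝ) ∞ (xR i) :=
    fun i ↦ (x i).contMDiff.comp hR.smooth
  have hσ : ∀ i j, ContMDiff 𝓘(ℝ, EuclideanSpace ℝ (Fin d)) 𝓘(ℝ, ℝ) ∞ (σ i j) :=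
    fun i j ↦ (S.contract (x i) (x j)).contMDiff.comp hR.smooth
  have hxd : ∀ i (q' : Leaf π b) (w : TangentSpace 𝓘(ℝ, EuclideanSpace ℝ (Fin d)) q'),
      dAt (E := EuclideanSpace ℝ (Fin d)) (xR i) q' w = α i q'.1 (leafInclDeriv E q' w) :=
    fun i q' w ↦ hR.dAt_restrict (x i).contMDiff q' w
  let coord : (∀ q : Leaf π b, TangentSpace 𝓘(ℝ, EuclideanSpace ℝ (Fin d)) q) →
      Fin d → Leaf π b → ℝ := fun W i q' ↦ dAt (E := EuclideanSpace ℝ (Fin d)) (xR i) q' (W q')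
  have hcoord : ∀ {W : ∀ q : Leaf π b, TangentSpace 𝓘(ℝ, EuclideanSpace ℝ (Fin d)) q},
      ContMDiff 𝓘(ℝ, EuclideanSpace ℝ (Fin d)) 𝓘(ℝ, EuclideanSpace ℝ (Fin d)).tangent ∞
        (fun q ↦ (⟨q, W q⟩ : TangentBundle 𝓘(ℝ, EuclideanSpace ℝ (Fin d)) (Leaf π b))) →
      ∀ i, ContMDiff 𝓘(ℝ, EuclideanSpace ℝ (Fin d)) 𝓘(ℝ, ℝ) ∞ (coord W i) :=
    fun hW i ↦ contMDiff_dAt_apply (hxR i) hW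
  -- the Gram matrix is regular at `q`
  have hinj : ∀ c : Fin d → ℝ, (∀ j, ∑ i, c i * σ i j q = 0) → c = 0 := by
    intro c hc
    -- For `c` in the kernel, the leaf vector `S♯(∑ c_i dx_i)` has all coordinates zero and so
    -- vanishes. Then `∑ c_i dx_i` annihilates the leaf, and the `j`-th coordinate vector gives `c j
    -- = 0`.
    have hm := hS.sharp_mem q.1 (∑ i, c i • α i q.1)
    obtain ⟨w, hw⟩ := hR.exists_leafInclDeriv_eq hπ hd q hm
    have hw0 : w = 0 := by
      refine PiLp.ext (x := w) (y := 0) fun j ↦ (hx w j).symm.trans ?_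
      rw [hw]
      exact (S.pair_sum q.1 c (fun i ↦ α i q.1) (α j q.1)).trans (hc j)
    rw [hw0, map_zero] at hw
    funext j
    have h1 := hS.apply_eq_zero hw.symm
      (hR.leafInclDeriv_mem hπ q (EuclideanSpace.single j (1 : ℝ)))
    have h2 : ∀ i, α i q.1 (leafInclDeriv E q (EuclideanSpace.single j (1 : ℝ)))
        = if i = j then 1 else 0 := by
      intro i
      refine (hx _ i).trans ?_
      simp
    simpa [h2] using h1
  obtain ⟨u, hu, hev⟩ := exists_contMDiffAt_solution (fun i j ↦ hσ i j q)
    (fun j ↦ hcoord hY j q) hinj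
  obtain ⟨-, hsurj⟩ := hev.self_of_nhds
  -- near `q`, the field `Y` is `S♯ (∑ i, u i dx_i)`
  have hYu : ∀ᶠ q' in 𝓝 q, leafInclDeriv E q' (Y q')
      = S.sharp q'.1 (∑ i, u i q' • α i q'.1) := by
    filter_upwards [hev] with q' hq'
    refine eq_sharp_sum_of_gram hS (hπ.dim q'.1) hd hq'.2 (hR.leafInclDeriv_mem hπ q' (Y q')) ?_
    intro j
    exact (hq'.1 j).trans (hxd j q' (Y q'))
  -- For `Z` coefficients at the single point `q` suffice; only those of `Y` are differentiated.
  obtain ⟨w, hw⟩ := hsurj fun j ↦ coord Z j q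
  have hZw : leafInclDeriv E q (Z q) = S.sharp q.1 (∑ j, w j • α j q.1) :=
    eq_sharp_sum_of_gram hS (hπ.dim q.1) hd hsurj (hR.leafInclDeriv_mem hπ q (Z q))
      fun j ↦ (hw j).trans (hxd j q (Z q))
  have hYq := hYu.self_of_nhds
  have hsum : ∀ (q' : Leaf π b) (c : Fin d → ℝ)
      (W : TangentSpace 𝓘(ℝ, EuclideanSpace ℝ (Fin d)) q'),
      (∑ i, c i • α i q'.1) (leafInclDeriv E q' W)
        = ∑ i, c i * dAt (E := EuclideanSpace ℝ (Fin d)) (xR i) q' W := by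
    intro q' c W
    simp [hxd]
  have hG : (fun q' ↦ leafMetric S π b d q' (Y q') (Z q'))
      =ᶠ[𝓝 q] fun q' ↦ ∑ i, u i q' * coord Z i q' := by
    filter_upwards [hYu] with q' hq'
    rw [hR.leafMetric_eq hπ hS hq', hsum]
  have hud : ∀ i, MDifferentiableAt 𝓘(ℝ, EuclideanSpace ℝ (Fin d)) 𝓘(ℝ, ℝ) (u i) q :=
    fun i ↦ (hu i).mdifferentiableAt (by simp)
  have hzd : ∀ i, MDifferentiableAt 𝓘(ℝ, EuclideanSpace ℝ (Fin d)) 𝓘(ℝ, ℝ) (coord Z i) q :=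
    fun i ↦ (hcoord hZ i).mdifferentiable (by simp) q
  have hσd : ∀ i j, MDifferentiableAt 𝓘(ℝ, EuclideanSpace ℝ (Fin d)) 𝓘(ℝ, ℝ) (σ i j) q :=
    fun i j ↦ (hσ i j).mdifferentiable (by simp) q
  -- derivatives along `X`
  have hDG : dAt (E := EuclideanSpace ℝ (Fin d)) (fun q' ↦ leafMetric S π b d q' (Y q') (Z q')) q
      (X q) = ∑ i, (u i q * dAt (E := EuclideanSpace ℝ (Fin d)) (coord Z i) q (X q)
        + coord Z i q * dAt (E := EuclideanSpace ℝ (Fin d)) (u i) q (X q)) := by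
    rw [dAt_congr hG, dAt_sum (f := fun i q' ↦ u i q' * coord Z i q') fun i _ ↦ (hud i).mul (hzd i)]
    exact Finset.sum_congr rfl fun i _ ↦ dAt_mul (hud i) (hzd i) _
  -- This is `L_v S = 0` evaluated on `x i` and `x j`, and the only use of that hypothesis.
  have hDσ : ∀ i j, dAt (E := EuclideanSpace ℝ (Fin d)) (σ i j) q (X q)
      = S.pair q.1 (dAt (V i) q.1) (α j q.1) + S.pair q.1 (α i q.1) (dAt (V j) q.1) := by
    intro i j
    have h1 := hL (x i) (x j) q.1
    rw [lieDeriv] at h1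
    have h2 := hR.dAt_restrict (S.contract (x i) (x j)).contMDiff q (X q)
    rw [hX] at h2
    refine h2.trans ?_
    linear_combination h1
  have hDy : ∀ j, dAt (E := EuclideanSpace ℝ (Fin d)) (coord Y j) q (X q)
      = ∑ i, (u i q * (S.pair q.1 (dAt (V i) q.1) (α j q.1) + S.pair q.1 (α i q.1) (dAt (V j) q.1))
        + σ i j q * dAt (E := EuclideanSpace ℝ (Fin d)) (u i) q (X q)) := by
    intro j
    have h1 : coord Y j =ᶠ[𝓝 q] fun q' ↦ ∑ i, u i q' * σ i j q' := by
      filter_upwards [hev] with q' hq'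
      exact (hq'.1 j).symm
    rw [dAt_congr h1, dAt_sum (f := fun i q' ↦ u i q' * σ i j q') fun i _ ↦ (hud i).mul (hσd i j)]
    refine Finset.sum_congr rfl fun i _ ↦ ?_
    rw [dAt_mul (hud i) (hσd i j), hDσ]
  -- brackets
  have hXx : ∀ i, coord X i = fun q' ↦ V i q'.1 := by
    intro i
    funext q'
    exact (hxd i q' (X q')).trans (by rw [hX])
  have hbr : ∀ {W : ∀ q : Leaf π b, TangentSpace 𝓘(ℝ, EuclideanSpace ℝ (Fin d)) q} {c : Fin d → ℝ},
      ContMDiff 𝓘(ℝ, EuclideanSpace ℝ (Fin d)) 𝓘(ℝ, EuclideanSpace ℝ (Fin d)).tangent ∞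
        (fun q ↦ (⟨q, W q⟩ : TangentBundle 𝓘(ℝ, EuclideanSpace ℝ (Fin d)) (Leaf π b))) →
      leafInclDeriv E q (W q) = S.sharp q.1 (∑ j, c j • α j q.1) →
      ∀ i, dAt (E := EuclideanSpace ℝ (Fin d)) (xR i) q
          (VectorField.mlieBracket 𝓘(ℝ, EuclideanSpace ℝ (Fin d)) X W q)
        = dAt (E := EuclideanSpace ℝ (Fin d)) (coord W i) q (X q)
          - ∑ j, c j * S.pair q.1 (α j q.1) (dAt (V i) q.1) := by
    intro W c hW hWc i
    have h1 := dAt_mlieBracket (hxR i) hXs hW q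
    have h2 : dAt (E := EuclideanSpace ℝ (Fin d)) (coord X i) q (W q)
        = ∑ j, c j * S.pair q.1 (α j q.1) (dAt (V i) q.1) := by
      rw [hXx, hR.dAt_restrict (hv (x i)), hWc]
      exact S.pair_sum q.1 c (fun j ↦ α j q.1) (dAt (V i) q.1)
    rw [← h2]
    exact h1
  -- Symmetry moves `[X, Y]` to the second slot, so that each metric term has a first argument of
  -- the form `S♯(∑ c_i dx_i)`.
  rw [hDG, hR.leafMetric_symm hπ hS q (VectorField.mlieBracket _ X Y q),
    hR.leafMetric_eq hπ hS hZw, hR.leafMetric_eq hπ hS hYq, hsum, hsum]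
  simp only [hbr hY hYq, hbr hZ hZw]
  have hsymm : ∀ i j, S.pair q.1 (α j q.1) (dAt (V i) q.1)
      = S.pair q.1 (dAt (V i) q.1) (α j q.1) := fun i j ↦ hS.symmetric _ _ _
  rw [sum_leibniz_solution (fun i ↦ u i q) w (fun i ↦ coord Z i q) _ _
    (fun j ↦ dAt (E := EuclideanSpace ℝ (Fin d)) (coord Y j) q (X q)) (fun i j ↦ σ i j q)
    (fun i j ↦ S.pair q.1 (dAt (V i) q.1) (α j q.1))
    (fun i j ↦ S.pair q.1 (α i q.1) (dAt (V j) q.1)) _ hDy]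
  · congr 1
    refine Finset.sum_congr rfl fun i _ ↦ ?_
    congr 2
    exact Finset.sum_congr rfl fun j _ ↦ by rw [hsymm]
  · intro i
    rw [← hw i]
    refine Finset.sum_congr rfl fun j _ ↦ ?_
    congr 1
    exact hS.symmetric q.1 _ _

/-- If the leaves are coisotropic, the Hamiltonian fields of functions on the leaf space restrict
to Killing fields of the leaves, which span `P♯ (ker S♯)`. -/
theorem IsLeafSubmanifold.exists_isKillingField (hR : IsLeafSubmanifold E π b d)
    [IsManifold 𝓘(ℝ, EuclideanSpace ℝ (Fin d)) ∞ (Leaf π b)]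
    [FiniteDimensional ℝ F] [IsManifold 𝓘(ℝ, F) ∞ B] [T2Space B]
    (hπ : IsLeafFibration E F π d) (hd : 1 ≤ d) {P S : ContraTensor E M}
    (hS : IsLeafStructure F π S) (hPS : IsCompatible F P π S)
    (hco : IsCoisotropicLeaf F P π b) {q : Leaf π b} {u : TangentSpace 𝓘(ℝ, E) q.1}
    (hu : u ∈ sharpKer P S q.1) :
    ∃ X : ∀ q' : Leaf π b, TangentSpace 𝓘(ℝ, EuclideanSpace ℝ (Fin d)) q',
      IsKillingField (leafMetric S π b d) X ∧ leafInclDeriv E q (X q) = u := by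
  -- The sign is that of `v_f = -P♯ df`: a preimage of `-u` is needed.
  obtain ⟨α, hα, hαu⟩ := neg_mem hu
  obtain ⟨f, rfl⟩ := hπ.exists_dAt_comp_eq fun w hw ↦ hS.apply_eq_zero hα hw
  have hfm : ContMDiff 𝓘(ℝ, E) 𝓘(ℝ, ℝ) ∞ (fun p ↦ f (π p)) := f.contMDiff.comp hπ.smooth
  have hmem : ∀ q' : Leaf π b,
      hamiltonianField P (fun p ↦ f (π p)) q'.1 ∈ leafTangent E F π q'.1 := by
    rintro ⟨p, rfl⟩
    exact hco.hamiltonianField_mem hπ f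
  choose X hX using fun q' ↦ hR.exists_leafInclDeriv_eq hπ hd q' (hmem q')
  refine ⟨X, hR.isKillingField_of_lift hπ hd hS (fun g ↦ ?_) (hPS f) hX, ?_⟩
  · have h : (fun p ↦ dAt (E := E) g p (hamiltonianField P (fun p ↦ f (π p)) p))
        = fun p ↦ -dAt (E := E) g p (P.sharp p (dAt (fun p ↦ f (π p)) p)) := by
      funext p
      rw [hamiltonianField, map_neg]
    rw [h]
    exact (P.smooth ⟨_, hfm⟩ g).neg
  · rw [hX, hamiltonianField, hαu, neg_neg]

end Killing

end PoissonGravity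

end

theorem mainTheorem8
    {E : Type*} [NormedAddCommGroup E] [NormedSpace ℝ E] [FiniteDimensional ℝ E]
    {F : Type*} [NormedAddCommGroup F] [NormedSpace ℝ F] [FiniteDimensional ℝ F]
    {M : Type*} [TopologicalSpace M] [T2Space M] [ChartedSpace E M] [IsManifold 𝓘(ℝ, E) ∞ M]
    {B : Type*} [TopologicalSpace B] [T2Space B] [ChartedSpace F B] [IsManifold 𝓘(ℝ, F) ∞ B]
    (P S : PoissonGravity.ContraTensor E M) (hP : P.IsPoisson)
    (π : M → B) (d : ℕ) (hd : 1 ≤ d) (hπ : PoissonGravity.IsLeafFibration E F π d)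
    (hS : PoissonGravity.IsLeafStructure F π S) (hPS : PoissonGravity.IsCompatible F P π S) :
    (PoissonGravity.LeafMetricsIndependent F P π ↔
      ∀ b : B, PoissonGravity.IsCoisotropicLeaf F P π b) ∧
    ((∀ b : B, PoissonGravity.IsCoisotropicLeaf F P π b) →
      ∀ (b : B) [ChartedSpace (EuclideanSpace ℝ (Fin d)) (PoissonGravity.Leaf π b)]
        [IsManifold 𝓘(ℝ, EuclideanSpace ℝ (Fin d)) ∞ (PoissonGravity.Leaf π b)],
        PoissonGravity.IsLeafSubmanifold E π b d →
        ∀ (q : PoissonGravity.Leaf π b) (k : ℕ),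
          k = Module.finrank ℝ (PoissonGravity.sharpKer P S q.1) →
          ∃ X : Fin k → ∀ q' : PoissonGravity.Leaf π b,
              TangentSpace 𝓘(ℝ, EuclideanSpace ℝ (Fin d)) q',
            (∀ i, PoissonGravity.IsKillingField (PoissonGravity.leafMetric S π b d) (X i)) ∧
            LinearIndependent ℝ (fun i ↦ X i q)) := by
  refine ⟨⟨PoissonGravity.isCoisotropicLeaf_of_leafMetricsIndependent hd hπ hS hPS,
    PoissonGravity.leafMetricsIndependent_of_isCoisotropicLeaf hπ⟩, ?_⟩
  intro hco b _ _ hR q k hk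
  subst hk
  have : FiniteDimensional ℝ (TangentSpace 𝓘(ℝ, E) q.1) := inferInstanceAs (FiniteDimensional ℝ E)
  -- Each basis vector of `P♯(ker S♯)` is the value at `q` of a Killing field; independence is
  -- checked after applying the derivative of the inclusion.
  let e := Module.finBasis ℝ (PoissonGravity.sharpKer P S q.1)
  choose X hXk hX using fun i ↦ hR.exists_isKillingField hπ hd hS hPS (hco b) (e i).2
  refine ⟨X, hXk, LinearIndependent.of_comp
    (PoissonGravity.leafInclDeriv (d := d) E q).toLinearMap ?_⟩
  have h : ⇑(PoissonGravity.leafInclDeriv (d := d) E q).toLinearMap ∘ (fun i ↦ X i q)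
      = (PoissonGravity.sharpKer P S q.1).subtype ∘ e := funext hX
  rw [h]
  exact e.linearIndependent.map' _ (Submodule.ker_subtype _)
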